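/- Let $n\ge 2$, $0<s<1$ and $1\le p<\infty$ with $sp<n$, put $p^*_s:=\frac{np}{n-sp}$, and let $1\le p^*_s\le r<q<\infty$. Let $V:\mathbb R^n\to(0,\infty)$ be Lebesgue measurable with $\inf_{D}V>0$ for every compact $D\subset\mathbb R^n$, and let $M_V^{s;q,p}(\mathbb R^n)$ be the completion of the set of all $u\in C^1_c(\mathbb R^n)$ of finite norm with respect to the norm $$\|u\|:=\Bigl(\int_{\mathbb R^n}|u|^qV\,dx\Bigr)^{1/q}+\Bigl(\int_{\mathbb R^n}\int_{\mathbb R^n}\frac{|u(x)-u(y)|^p}{|x-y|^{n+sp}}\,dx\,dy\Bigr)^{1/p},$$ its elements being regarded as functions on $\mathbb R^n$ (up to equality almost everywhere) through their limits in $L^q(V\,dx)$. Let $K:\mathbb R^n\to(0,\infty)$ satisfy $K\in L^t_{\mathrm{loc}}(\mathbb R^n)$ for some $t\in\bigl(\frac{q}{q-r},\infty\bigr]$, and suppose that, with $\tau:=\frac{r-p^*_s}{q-p^*_s}$, $K(x)V(x)^{-\tau}\to0$ as $|x|\to\infty$ (i.e. $\sup_{|x|\ge R}K(x)V(x)^{-\tau}\to0$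 as $R\to\infty$). Then $M_V^{s;q,p}(\mathbb R^n)$ embeds compactly into $L^r(K;\mathbb R^n)$, the Lebesgue space with norm $\bigl(\int_{\mathbb R^n}|u|^rK\,dx\bigr)^{1/r}$: every element of $M_V^{s;q,p}(\mathbb R^n)$ belongs to $L^r(K;\mathbb R^n)$ as a function, and the resulting inclusion map is linear, continuous, injective and compact. -/

import Mathlib

open MeasureTheory Filter Topology Set
open scoped ENNReal NNReal

noncomputable section

/-- An exponent `1 ≤ p < ∞` given as a real number is also `≥ 1` as an extended nonnegative real;
this provides the Banach space structure on the Lebesgue spaces below. -/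
instance fact_one_le_ofReal {p : ℝ} [hp : Fact (1 ≤ p)] : Fact (1 ≤ ENNReal.ofReal p) :=
  ⟨by simpa using ENNReal.ofReal_le_ofReal hp.out⟩

namespace WeightedFracSobolev

/-- Euclidean space `ℝⁿ`. -/
abbrev Rn (n : ℕ) : Type := EuclideanSpace ℝ (Fin n)

/-- The critical fractional Sobolev exponent `p*_s = n p / (n - s p)` (meaningful for `s p < n`). -/
def critExp (n : ℕ) (s p : ℝ) : ℝ := (n * p) / (n - s * p)

/-- The measure `w(x) dx` on `ℝⁿ`. -/
def weightMeasure {n : ℕ} (w : Rn n → ℝ) : Measure (Rn n) :=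
  volume.withDensity fun x => ENNReal.ofReal (w x)

/-- The weighted Lebesgue space `L^r(w; ℝⁿ)`, with norm `(∫ |u|^r w dx)^{1/r}`. -/
abbrev WeightedLp {n : ℕ} (r : ℝ) (w : Rn n → ℝ) : Type :=
  Lp ℝ (ENNReal.ofReal r) (weightMeasure w)

/-- The weighted Lebesgue norm `(∫ |u|^q V dx)^{1/q}`, as an extended nonnegative real. -/
def weightNorm {n : ℕ} (q : ℝ) (V : Rn n → ℝ) (u : Rn n → ℝ) : ℝ≥0∞ :=
  eLpNorm u (ENNReal.ofReal q) (weightMeasure V)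

/-- The difference quotient `(u(x) - u(y)) / |x - y|^{n/p + s}` on `ℝⁿ × ℝⁿ`. -/
def diffQuot {n : ℕ} (s p : ℝ) (u : Rn n → ℝ) (z : Rn n × Rn n) : ℝ :=
  (u z.1 - u z.2) / ‖z.1 - z.2‖ ^ (n / p + s)

/-- The Gagliardo seminorm `[u]_{s,p} = (∬ |u(x) - u(y)|^p / |x - y|^{n + s p} dx dy)^{1/p}` on
`ℝⁿ`, as an extended nonnegative real; see `gagliardo_eq`. -/
def gagliardo {n : ℕ} (s p : ℝ) (u : Rn n → ℝ) : ℝ≥0∞ :=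
  eLpNorm (diffQuot s p u) (ENNReal.ofReal p) (volume : Measure (Rn n × Rn n))

theorem gagliardo_eq {n : ℕ} {s p : ℝ} (hp : 1 ≤ p) (u : Rn n → ℝ) :
    gagliardo s p u =
      (∫⁻ z : Rn n × Rn n,
        ENNReal.ofReal (|u z.1 - u z.2| ^ p / ‖z.1 - z.2‖ ^ (n + s * p))) ^ (1 / p) := by
  have hp0 : 0 < p := by linarith
  rw [gagliardo, eLpNorm_eq_lintegral_rpow_enorm_toReal (by simpa using hp0) (by simp),
    ENNReal.toReal_ofReal hp0.le]
  congr 2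
  funext z
  have h0 : (0 : ℝ) ≤ ‖z.1 - z.2‖ ^ (n / p + s) := by positivity
  rw [← ofReal_norm, ENNReal.ofReal_rpow_of_nonneg (norm_nonneg _) hp0.le, diffQuot,
    Real.norm_eq_abs, abs_div, abs_of_nonneg h0, Real.div_rpow (abs_nonneg _) h0,
    ← Real.rpow_mul (norm_nonneg _)]
  congr 4
  field_simp

theorem diffQuot_add {n : ℕ} (s p : ℝ) (u v : Rn n → ℝ) :
    diffQuot s p (u + v) = diffQuot s p u + diffQuot s p v := by
  funext z
  simp only [diffQuot, Pi.add_apply]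
  ring

theorem diffQuot_smul {n : ℕ} (s p c : ℝ) (u : Rn n → ℝ) :
    diffQuot s p (c • u) = c • diffQuot s p u := by
  funext z
  simp only [diffQuot, Pi.smul_apply, smul_eq_mul]
  ring

theorem aestronglyMeasurable_diffQuot {n : ℕ} (s p : ℝ) {u : Rn n → ℝ} (hu : Continuous u) :
    AEStronglyMeasurable (diffQuot s p u) (volume : Measure (Rn n × Rn n)) := by
  have hm : Measurable (diffQuot s p u) := by
    unfold diffQuot
    have := hu.measurable
    fun_prop
  exact hm.aestronglyMeasurable

variable {n : ℕ} {s p q : ℝ} {V : Rn n → ℝ}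

theorem weightNorm_add_le [Fact (1 ≤ q)] {u v : Rn n → ℝ} (hu : Continuous u)
    (hv : Continuous v) : weightNorm q V (u + v) ≤ weightNorm q V u + weightNorm q V v :=
  eLpNorm_add_le hu.aestronglyMeasurable hv.aestronglyMeasurable
    (Fact.out : 1 ≤ ENNReal.ofReal q)

theorem gagliardo_add_le [Fact (1 ≤ p)] {u v : Rn n → ℝ} (hu : Continuous u)
    (hv : Continuous v) : gagliardo s p (u + v) ≤ gagliardo s p u + gagliardo s p v := by
  unfold gagliardo
  rw [diffQuot_add]
  exact eLpNorm_add_le (aestronglyMeasurable_diffQuot s p hu)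
    (aestronglyMeasurable_diffQuot s p hv) (Fact.out : 1 ≤ ENNReal.ofReal p)

theorem weightNorm_smul (c : ℝ) (u : Rn n → ℝ) :
    weightNorm q V (c • u) = ‖c‖ₑ * weightNorm q V u :=
  eLpNorm_const_smul c u _ _

theorem gagliardo_smul (c : ℝ) (u : Rn n → ℝ) :
    gagliardo s p (c • u) = ‖c‖ₑ * gagliardo s p u := by
  unfold gagliardo
  rw [diffQuot_smul]
  exact eLpNorm_const_smul c _ _ _

variable (s p q V) in
/-- The functions `u ∈ C¹_c(ℝⁿ)` of finite norm `(∫ |u|^q V dx)^{1/q} + [u]_{s,p}`.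
(For `0 < s < 1 ≤ p` the seminorm `[u]_{s,p}` of a function in `C¹_c(ℝⁿ)` is always finite, and if
`V` is locally integrable then so is the weighted norm.) -/
def testSubmodule [Fact (1 ≤ p)] [Fact (1 ≤ q)] : Submodule ℝ (Rn n → ℝ) where
  carrier := {u | ContDiff ℝ 1 u ∧ HasCompactSupport u ∧
    weightNorm q V u ≠ ∞ ∧ gagliardo s p u ≠ ∞}
  add_mem' := by
    rintro u v ⟨hu1, hu2, hu3, hu4⟩ ⟨hv1, hv2, hv3, hv4⟩
    exact ⟨hu1.add hv1, hu2.add hv2,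
      ne_top_of_le_ne_top (ENNReal.add_ne_top.2 ⟨hu3, hv3⟩)
        (weightNorm_add_le hu1.continuous hv1.continuous),
      ne_top_of_le_ne_top (ENNReal.add_ne_top.2 ⟨hu4, hv4⟩)
        (gagliardo_add_le hu1.continuous hv1.continuous)⟩
  zero_mem' := by
    refine ⟨contDiff_const, HasCompactSupport.zero, ?_, ?_⟩
    · simp [weightNorm]
    · have h : diffQuot s p (0 : Rn n → ℝ) = 0 := by
        funext z
        simp [diffQuot]
      simp [gagliardo, h]
  smul_mem' := by
    rintro c u ⟨hu1, hu2, hu3, hu4⟩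
    refine ⟨contDiff_const.smul hu1, hu2.smul_left (f := fun _ => c), ?_, ?_⟩
    · rw [weightNorm_smul]
      exact ENNReal.mul_ne_top enorm_ne_top hu3
    · rw [gagliardo_smul]
      exact ENNReal.mul_ne_top enorm_ne_top hu4

variable (s p q V) in
/-- The space of functions in `C¹_c(ℝⁿ)` of finite norm `(∫ |u|^q V dx)^{1/q} + [u]_{s,p}`, as a
type of its own that carries only this norm (and not the topology of pointwise convergence). -/
def TestFun [Fact (1 ≤ p)] [Fact (1 ≤ q)] : Type := testSubmodule s p q V

namespace TestFun

variable [Fact (1 ≤ p)] [Fact (1 ≤ q)]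

instance : AddCommGroup (TestFun s p q V) :=
  inferInstanceAs (AddCommGroup (testSubmodule s p q V))

instance : Module ℝ (TestFun s p q V) :=
  inferInstanceAs (Module ℝ (testSubmodule s p q V))

/-- The underlying function of a test function. -/
def toFun (u : TestFun s p q V) : Rn n → ℝ := u.1

theorem toFun_add (u v : TestFun s p q V) : (u + v).toFun = u.toFun + v.toFun := rfl

theorem toFun_smul (c : ℝ) (u : TestFun s p q V) : (c • u).toFun = c • u.toFun := rfl

theorem contDiff (u : TestFun s p q V) : ContDiff ℝ 1 u.toFun := u.2.1

theorem hasCompactSupport (u : TestFun s p q V) : HasCompactSupport u.toFun := u.2.2.1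

theorem weightNorm_ne_top (u : TestFun s p q V) : weightNorm q V u.toFun ≠ ∞ := u.2.2.2.1

theorem gagliardo_ne_top (u : TestFun s p q V) : gagliardo s p u.toFun ≠ ∞ := u.2.2.2.2

/-- The norm `(∫ |u|^q V dx)^{1/q} + [u]_{s,p}`. -/
instance : Norm (TestFun s p q V) :=
  ⟨fun u => (weightNorm q V u.toFun).toReal + (gagliardo s p u.toFun).toReal⟩

theorem norm_def (u : TestFun s p q V) :
    ‖u‖ = (weightNorm q V u.toFun).toReal + (gagliardo s p u.toFun).toReal := rfl

theorem norm_core : SeminormedSpace.Core ℝ (TestFun s p q V) where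
  norm_nonneg u := by
    rw [norm_def]
    positivity
  norm_smul c u := by
    simp only [norm_def, toFun_smul, weightNorm_smul, gagliardo_smul, ENNReal.toReal_mul,
      toReal_enorm]
    ring
  norm_triangle u v := by
    simp only [norm_def, toFun_add]
    have h1 := ENNReal.toReal_mono (ENNReal.add_ne_top.2 ⟨u.weightNorm_ne_top, v.weightNorm_ne_top⟩)
      (weightNorm_add_le (q := q) (V := V) u.contDiff.continuous v.contDiff.continuous)
    have h2 := ENNReal.toReal_mono (ENNReal.add_ne_top.2 ⟨u.gagliardo_ne_top, v.gagliardo_ne_top⟩)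
      (gagliardo_add_le (s := s) (p := p) u.contDiff.continuous v.contDiff.continuous)
    rw [ENNReal.toReal_add u.weightNorm_ne_top v.weightNorm_ne_top] at h1
    rw [ENNReal.toReal_add u.gagliardo_ne_top v.gagliardo_ne_top] at h2
    linarith

instance : SeminormedAddCommGroup (TestFun s p q V) := SeminormedAddCommGroup.ofCore norm_core

instance : NormedSpace ℝ (TestFun s p q V) where
  norm_smul_le c u := (norm_core.norm_smul c u).le

theorem memLp (u : TestFun s p q V) : MemLp u.toFun (ENNReal.ofReal q) (weightMeasure V) :=
  ⟨u.contDiff.continuous.aestronglyMeasurable, u.weightNorm_ne_top.lt_top⟩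

variable (s p q V) in
/-- A test function, seen as an element of `L^q(V; ℝⁿ)`. -/
def toWeightedLp : TestFun s p q V →L[ℝ] WeightedLp q V :=
  LinearMap.mkContinuous
    { toFun := fun u => u.memLp.toLp u.toFun
      map_add' := fun u v => MemLp.toLp_add u.memLp v.memLp
      map_smul' := fun c u => MemLp.toLp_const_smul c u.memLp } 1 (by
    intro u
    rw [one_mul, norm_def]
    change ‖u.memLp.toLp u.toFun‖ ≤ _
    rw [Lp.norm_toLp]
    exact le_add_of_nonneg_right ENNReal.toReal_nonneg)

end TestFun

variable (s p q V) in
/-- The space `M_V^{s;q,p}(ℝⁿ)`: the completion of the set of `C¹_c(ℝⁿ)` functions of finite norm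
with respect to the norm `‖u‖ = (∫ |u|^q V dx)^{1/q} + [u]_{s,p}`. -/
abbrev MSpace [Fact (1 ≤ p)] [Fact (1 ≤ q)] : Type :=
  UniformSpace.Completion (TestFun s p q V)

namespace MSpace

variable [Fact (1 ≤ p)] [Fact (1 ≤ q)]

variable (s p q V) in
/-- The canonical map `M_V^{s;q,p}(ℝⁿ) → L^q(V; ℝⁿ)`, i.e. the continuous extension of the identity
on test functions; it is how elements of the completion are regarded as functions on `ℝⁿ`. -/
def toWeightedLp : MSpace s p q V →L[ℝ] WeightedLp q V :=
  (TestFun.toWeightedLp s p q V).extend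
    (UniformSpace.Completion.toComplL : TestFun s p q V →L[ℝ] MSpace s p q V)

theorem toWeightedLp_coe (u : TestFun s p q V) :
    toWeightedLp s p q V (u : MSpace s p q V) = TestFun.toWeightedLp s p q V u := by
  have h := ContinuousLinearMap.extend_eq (TestFun.toWeightedLp s p q V)
    (e := (UniformSpace.Completion.toComplL : TestFun s p q V →L[ℝ] MSpace s p q V))
    (by simpa using UniformSpace.Completion.denseRange_coe)
    (by simpa using UniformSpace.Completion.isUniformInducing_coe (TestFun s p q V)) u
  simpa [toWeightedLp] using h

/-- The function on `ℝⁿ` (defined almost everywhere) represented by `u ∈ M_V^{s;q,p}(ℝⁿ)`. -/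
def toFun (u : MSpace s p q V) : Rn n → ℝ := toWeightedLp s p q V u

/-- A test function represents itself. -/
theorem toFun_coe (u : TestFun s p q V) :
    toFun (u : MSpace s p q V) =ᵐ[weightMeasure V] u.toFun := by
  unfold toFun
  rw [toWeightedLp_coe]
  exact u.memLp.coeFn_toLp

end MSpace

end WeightedFracSobolev

end

/-! Compactness comes from a finite-dimensional criterion rather than from weak limits, so `p = 1`
needs no separate treatment. If for every `ε` there are finitely many bounded functionals such that
the unit-ball elements on which they are at most `1` have image of norm at most `ε`, then the image
of the unit ball is totally bounded (`LinearMap.exists_compact_extension`).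

For the embedding, `ℝⁿ` is split into a large ball `D` and its complement. On the complement `K ≤ η
V ^ τ` with `η` small, and since `r = (1 - τ) p*_s + τ q`, Hölder's inequality interpolates between
`L^{p*_s}`, which the fractional Sobolev inequality `lintegral_critExp_rpow_le` controls, and
`L^q(V)` (`exists_tail_le`). On `D` the weight `V` is bounded below and `K` has integrability
strictly above `q / (q - r)`, so Hölder's inequality leaves a positive power of `∫_D |u|^p`
(`exists_local_le`). A fractional Poincaré inequality on small balls covering `D` makes this
integral small once the averages over those balls are small (`exists_finite_averages_control`).
These averages are the required functionals.

Injectivity amounts to closability of the norm. If test functions converge in the completion and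
tend to zero in `L^q(V)`, then along a subsequence their difference quotients tend to zero almost
everywhere, so the limit of these in `L^p` is zero too (`MSpace.eq_zero_of_toWeightedLp_eq_zero`).
-/

/-! ### A compactness criterion by finitely many linear constraints. -/

/-- A linear map is continuous at `0`, hence continuous, if it is small on the unit ball up to
finitely many bounded linear constraints. -/
theorem LinearMap.continuous_of_small_of_constraints {E Y : Type*} [SeminormedAddCommGroup E]
    [NormedSpace ℝ E] [NormedAddCommGroup Y] [NormedSpace ℝ Y] (T₀ : E →ₗ[ℝ] Y)
    (H : ∀ ε : ℝ, 0 < ε → ∃ (ι : Type) (_ : Fintype ι) (A : E →L[ℝ] (ι → ℝ)),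
      ∀ u, ‖u‖ ≤ 1 → ‖A u‖ ≤ 1 → ‖T₀ u‖ ≤ ε) : Continuous T₀ := by
  refine continuous_of_continuousAt_zero T₀ ?_
  rw [Metric.continuousAt_iff]
  intro ε hε
  obtain ⟨ι, _, A, hA⟩ := H (ε / 2) (by positivity)
  refine ⟨1 / (1 + ‖A‖), by positivity, fun {u} hu => ?_⟩
  rw [dist_zero_right] at hu
  rw [map_zero, dist_zero_right]
  have h1 : ‖u‖ * (1 + ‖A‖) < 1 := by rwa [lt_div_iff₀ (by positivity)] at hu
  have h2 := A.le_opNorm u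
  have h3 := norm_nonneg u
  have h4 := norm_nonneg A
  have := hA u (by nlinarith) (by nlinarith)
  linarith

/-- A linear map that is small on the unit ball up to finitely many bounded linear constraints
extends to a compact operator on the completion. -/
theorem LinearMap.exists_compact_extension {E Y : Type*} [SeminormedAddCommGroup E]
    [NormedSpace ℝ E] [NormedAddCommGroup Y] [NormedSpace ℝ Y] [CompleteSpace Y] (T₀ : E →ₗ[ℝ] Y)
    (H : ∀ ε : ℝ, 0 < ε → ∃ (ι : Type) (_ : Fintype ι) (A : E →L[ℝ] (ι → ℝ)),
      ∀ u, ‖u‖ ≤ 1 → ‖A u‖ ≤ 1 → ‖T₀ u‖ ≤ ε) :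
    ∃ T : UniformSpace.Completion E →L[ℝ] Y, (∀ u : E, T u = T₀ u) ∧ IsCompactOperator T := by
  let T₁ : E →L[ℝ] Y := ⟨T₀, T₀.continuous_of_small_of_constraints H⟩
  let T : UniformSpace.Completion E →L[ℝ] Y :=
    T₁.extend (UniformSpace.Completion.toComplL : E →L[ℝ] UniformSpace.Completion E)
  have hT : ∀ u : E, T u = T₀ u := fun u => by
    have h := ContinuousLinearMap.extend_eq T₁
      (e := (UniformSpace.Completion.toComplL : E →L[ℝ] UniformSpace.Completion E))
      (by simpa using UniformSpace.Completion.denseRange_coe)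
      (by simpa using UniformSpace.Completion.isUniformInducing_coe E) u
    exact h
  have hTB : TotallyBounded (T₀ '' Metric.ball 0 1) := by
    rw [Metric.totallyBounded_iff]
    intro ε hε
    obtain ⟨ι, _, A, hA⟩ := H (ε / 4) (by positivity)
    have hAb : TotallyBounded (A '' Metric.ball 0 1) := by
      have : Bornology.IsBounded (A '' Metric.ball 0 1) :=
        (A.lipschitz.isBounded_image Metric.isBounded_ball)
      exact this.isCompact_closure.totallyBounded.subset subset_closure
    -- The centres lie in the image itself, so they come from elements `v` of the unit ball. Radius
    -- `2` fits the halving of `u - v` below: the half satisfies both constraints, whence `‖T₀ (u -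
    -- v)‖ ≤ 2 * (ε / 4) < ε`.
    obtain ⟨t, hts, htf, hcov⟩ := Metric.finite_approx_of_totallyBounded hAb 2 (by norm_num)
    obtain ⟨t', ht's, ht'f, rfl⟩ := Set.exists_subset_image_finite_and.1 ⟨t, hts, htf, rfl⟩
    refine ⟨T₀ '' t', ht'f.image _, ?_⟩
    rintro _ ⟨u, hu, rfl⟩
    have := hcov (mem_image_of_mem A hu)
    simp only [mem_iUnion, Metric.mem_ball, exists_prop, mem_image, exists_exists_and_eq_and]
      at this ⊢
    obtain ⟨v, hv, huv⟩ := this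
    refine ⟨v, hv, ?_⟩
    have hv1 := ht's hv
    rw [mem_ball_zero_iff] at hu hv1
    rw [dist_eq_norm] at huv ⊢
    have h1 := hA ((1 / 2 : ℝ) • (u - v))
      (by rw [norm_smul]; norm_num; linarith [norm_sub_le u v])
      (by rw [map_smul, map_sub, norm_smul]; norm_num; linarith)
    rw [map_smul, map_sub, norm_smul] at h1
    norm_num at h1
    linarith
  refine ⟨T, hT, closure (T₀ '' Metric.ball 0 1), ?_, ?_⟩
  · exact hTB.closure.isCompact_of_isClosed isClosed_closure
  · refine mem_of_superset (Metric.ball_mem_nhds 0 one_pos) fun x hx => ?_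
    -- The ball is open, so its points are limits of elements of `E` in the same ball.
    have h1 := UniformSpace.Completion.denseRange_coe (α := E) |>.open_subset_closure_inter
      (Metric.isOpen_ball (x := (0 : UniformSpace.Completion E)) (ε := 1)) hx
    have h2 : T x ∈ closure (T '' (Metric.ball 0 1 ∩
        Set.range (UniformSpace.Completion.coe' : E → _))) :=
      image_closure_subset_closure_image T.continuous (mem_image_of_mem T h1)
    refine closure_mono ?_ h2
    rintro _ ⟨_, ⟨hy, ⟨u, rfl⟩⟩, rfl⟩
    refine ⟨u, ?_, (hT u).symm⟩
    rw [mem_ball_zero_iff] at hy ⊢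
    simpa using hy

/-! ### Averages over balls; fractional Poincaré and Sobolev inequalities. -/

noncomputable section
namespace WeightedFracSobolev

/-- This is Jensen's inequality for the power `m`, derived from Hölder's inequality against the
constant `1`. No integrability is needed: the Bochner average of a non-integrable function is `0`.
-/
theorem enorm_average_rpow_le {α : Type*} [MeasurableSpace α] {μ : Measure α} [IsFiniteMeasure μ]
    (hμ : μ ≠ 0) {w : α → ℝ} (hw : AEMeasurable w μ) {m : ℝ} (hm : 1 ≤ m) :
    ‖⨍ x, w x ∂μ‖ₑ ^ m ≤ (μ univ)⁻¹ * ∫⁻ x, ‖w x‖ₑ ^ m ∂μ := by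
  have hm0 : 0 < m := by linarith
  have hμ0 : μ univ ≠ 0 := by simpa using hμ
  have hμt : μ univ ≠ ∞ := measure_ne_top μ univ
  have h1 : ‖⨍ x, w x ∂μ‖ₑ ≤ (μ univ)⁻¹ * ∫⁻ x, ‖w x‖ₑ ∂μ := by
    rw [average_eq, enorm_smul]
    gcongr
    · rw [measureReal_def, ← ENNReal.toReal_inv, ← ofReal_norm, Real.norm_eq_abs,
        abs_of_nonneg ENNReal.toReal_nonneg, ENNReal.ofReal_toReal (by simpa using hμ0)]
    · exact enorm_integral_le_lintegral_enorm _
  have h2 : ∫⁻ x, ‖w x‖ₑ ∂μ ≤ (∫⁻ x, ‖w x‖ₑ ^ m ∂μ) ^ (1 / m) * (μ univ) ^ (1 - 1 / m) := by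
    have := ENNReal.lintegral_mul_norm_pow_le (μ := μ) (f := fun x => ‖w x‖ₑ ^ m)
      (g := fun _ => 1) (hw.enorm.pow_const m) aemeasurable_const (p := 1 / m) (q := 1 - 1 / m)
      (by positivity) (by rw [sub_nonneg, div_le_one hm0]; exact hm) (by ring)
    simpa [← ENNReal.rpow_mul, hm0.ne'] using this
  calc ‖⨍ x, w x ∂μ‖ₑ ^ m
      ≤ ((μ univ)⁻¹ * ((∫⁻ x, ‖w x‖ₑ ^ m ∂μ) ^ (1 / m) * (μ univ) ^ (1 - 1 / m))) ^ m := by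
        gcongr
        exact h1.trans (by gcongr)
    _ = (μ univ)⁻¹ * ∫⁻ x, ‖w x‖ₑ ^ m ∂μ := by
        rw [ENNReal.mul_rpow_of_nonneg _ _ hm0.le, ENNReal.mul_rpow_of_nonneg _ _ hm0.le,
          ← ENNReal.rpow_mul, ← ENNReal.rpow_mul, one_div_mul_cancel hm0.ne', ENNReal.rpow_one,
          ← ENNReal.rpow_neg_one, ← ENNReal.rpow_mul, mul_left_comm,
          ← ENNReal.rpow_add _ _ hμ0 hμt, mul_comm]
        congr 2
        field_simp
        ring

variable {n : ℕ} {s p : ℝ}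

/-- The inner integral `∫ |u(x) - u(y)|^p / |x - y|^{n + s p} dy` of the Gagliardo seminorm. -/
def innerGagliardo (s p : ℝ) (u : Rn n → ℝ) (x : Rn n) : ℝ≥0∞ :=
  ∫⁻ y, ‖diffQuot s p u (x, y)‖ₑ ^ p

theorem measurable_diffQuot {u : Rn n → ℝ} (hu : Continuous u) :
    Measurable (diffQuot s p u) := by
  unfold diffQuot
  have := hu.measurable
  fun_prop

theorem measurable_innerGagliardo {u : Rn n → ℝ} (hu : Continuous u) :
    Measurable (innerGagliardo s p u) := by
  have h : Measurable fun z : Rn n × Rn n => ‖diffQuot s p u z‖ₑ ^ p :=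
    (measurable_diffQuot hu).enorm.pow_const p
  exact h.lintegral_prod_right'

theorem lintegral_innerGagliardo {u : Rn n → ℝ} (hu : Continuous u) (hp : 0 < p) :
    ∫⁻ x, innerGagliardo s p u x = gagliardo s p u ^ p := by
  have h : Measurable fun z : Rn n × Rn n => ‖diffQuot s p u z‖ₑ ^ p :=
    (measurable_diffQuot hu).enorm.pow_const p
  rw [gagliardo, eLpNorm_eq_lintegral_rpow_enorm_toReal (by simpa using hp) (by simp),
    ENNReal.toReal_ofReal hp.le, ← ENNReal.rpow_mul, one_div_mul_cancel hp.ne', ENNReal.rpow_one,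
    Measure.volume_eq_prod, lintegral_prod _ h.aemeasurable]
  rfl

variable (n) in
/-- The volume of the unit ball of `ℝⁿ`. -/
def unitBallVol : ℝ := (volume (Metric.ball (0 : Rn n) 1)).toReal

theorem unitBallVol_pos : 0 < unitBallVol n :=
  ENNReal.toReal_pos (Metric.measure_ball_pos _ _ one_pos).ne' measure_ball_lt_top.ne

theorem volume_ball_eq (a : Rn n) {R : ℝ} (hR : 0 < R) :
    volume (Metric.ball a R) = ENNReal.ofReal (unitBallVol n * R ^ (n : ℝ)) := by
  rw [Measure.addHaar_ball_of_pos _ _ hR, finrank_euclideanSpace, Fintype.card_fin, mul_comm,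
    ENNReal.ofReal_mul unitBallVol_pos.le, unitBallVol,
    ENNReal.ofReal_toReal measure_ball_lt_top.ne, Real.rpow_natCast]

/-- The fractional Poincaré inequality on a ball, pointwise. -/
theorem enorm_sub_average_rpow_le (hs : 0 ≤ s) (hp : 1 ≤ p) {u : Rn n → ℝ} (hu : Continuous u)
    {a x : Rn n} {R : ℝ} (hR : 0 < R) (hx : x ∈ Metric.ball a R) :
    ‖u x - ⨍ y in Metric.ball a R, u y‖ₑ ^ p ≤
      ENNReal.ofReal (2 ^ (n + s * p) / unitBallVol n * R ^ (s * p)) *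
        innerGagliardo s p u x := by
  have hp0 : 0 < p := by linarith
  have hω := unitBallVol_pos (n := n)
  have hvol := volume_ball_eq a hR
  have hpos : 0 < unitBallVol n * R ^ (n : ℝ) := by positivity
  set B := Metric.ball a R
  have hB0 : volume B ≠ 0 := (Metric.measure_ball_pos _ _ hR).ne'
  have hBt : volume B ≠ ∞ := measure_ball_lt_top.ne
  have : IsFiniteMeasure (volume.restrict B) := ⟨by simpa using hBt.lt_top⟩
  have hint : IntegrableOn u B :=
    (hu.continuousOn.integrableOn_compact (isCompact_closedBall a R)).mono_set
      Metric.ball_subset_closedBall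
  have havg : u x - ⨍ y in B, u y = ⨍ y in B, (u x - u y) := by
    conv_lhs => rw [← setAverage_const hB0 hBt (u x)]
    simp only [setAverage_eq]
    rw [integral_sub (integrable_const _) hint, smul_sub]
  rw [havg]
  refine (enorm_average_rpow_le (by simpa [Measure.restrict_eq_zero] using hB0)
    ((continuous_const.sub hu).aemeasurable) hp).trans ?_
  -- Two points of the ball are at distance at most `2 * R`, which bounds the denominator of the
  -- difference quotient.
  have h1 : ∀ y ∈ B, ‖u x - u y‖ₑ ^ p ≤
      ENNReal.ofReal ((2 * R) ^ (n + s * p)) * ‖diffQuot s p u (x, y)‖ₑ ^ p := by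
    intro y hy
    have hxy : ‖x - y‖ ≤ 2 * R := by
      rw [← dist_eq_norm]
      have := dist_triangle_right x y a
      rw [Metric.mem_ball] at hx hy
      linarith
    have h2 : ‖u x - u y‖ₑ ≤
        ENNReal.ofReal ((2 * R) ^ (n / p + s)) * ‖diffQuot s p u (x, y)‖ₑ := by
      rw [← ofReal_norm, ← ofReal_norm, ← ENNReal.ofReal_mul (by positivity)]
      apply ENNReal.ofReal_le_ofReal
      rcases eq_or_ne x y with rfl | hne
      · simp only [sub_self, norm_zero]
        positivity
      · have hd : 0 < ‖x - y‖ := norm_pos_iff.2 (sub_ne_zero.2 hne)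
        have h3 : 0 < ‖x - y‖ ^ (n / p + s) := by positivity
        simp only [diffQuot, norm_div, Real.norm_of_nonneg h3.le]
        rw [mul_div_assoc', le_div_iff₀ h3, mul_comm]
        gcongr
    calc _ ≤ (ENNReal.ofReal ((2 * R) ^ (n / p + s)) * ‖diffQuot s p u (x, y)‖ₑ) ^ p := by gcongr
      _ = _ := by
        rw [ENNReal.mul_rpow_of_nonneg _ _ hp0.le,
          ENNReal.ofReal_rpow_of_nonneg (by positivity) hp0.le, ← Real.rpow_mul (by positivity)]
        congr 3
        field_simp
  calc (volume.restrict B univ)⁻¹ * ∫⁻ y in B, ‖u x - u y‖ₑ ^ p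
      ≤ (volume B)⁻¹ *
        ∫⁻ y in B, ENNReal.ofReal ((2 * R) ^ (n + s * p)) * ‖diffQuot s p u (x, y)‖ₑ ^ p := by
        rw [Measure.restrict_apply_univ]
        gcongr _ * ?_
        exact setLIntegral_mono' measurableSet_ball h1
    _ ≤ (volume B)⁻¹ * (ENNReal.ofReal ((2 * R) ^ (n + s * p)) * innerGagliardo s p u x) := by
        rw [lintegral_const_mul' _ _ ENNReal.ofReal_ne_top]
        gcongr
        exact setLIntegral_le_lintegral _ _
    _ = _ := by
        rw [hvol, ← ENNReal.ofReal_inv_of_pos hpos, ← mul_assoc,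
          ← ENNReal.ofReal_mul (by positivity)]
        congr 2
        rw [Real.mul_rpow (by norm_num) hR.le, Real.rpow_add hR]
        field_simp

/-- The fractional Sobolev inequality. -/
theorem lintegral_critExp_rpow_le (hn : 0 < n) (hs : 0 < s) (hp : 1 ≤ p) (hsp : s * p < n) :
    ∃ C : ℝ≥0∞, C ≠ ∞ ∧ ∀ u : Rn n → ℝ, Continuous u → HasCompactSupport u →
      ∫⁻ x, ‖u x‖ₑ ^ critExp n s p ≤ C * gagliardo s p u ^ critExp n s p := by
  have hp0 : 0 < p := by linarith
  have hω := unitBallVol_pos (n := n)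
  have hn0 : (0 : ℝ) < n := by exact_mod_cast hn
  have hd : 0 < n - s * p := by linarith
  set m := critExp n s p with hm
  have hmp : p ≤ m := by
    rw [hm, critExp, le_div_iff₀ hd]
    nlinarith [mul_pos hs hp0]
  have hm0 : 0 < m := by linarith
  set κ : ℝ := s * p / n with hκ
  have hκ0 : 0 < κ := by positivity
  have hκ1 : κ < 1 := by rw [hκ, div_lt_one hn0]; exact hsp
  have hmκ : m * (1 - κ) = p := by
    rw [hm, hκ, critExp, div_mul_eq_mul_div, div_eq_iff hd.ne']
    field_simp
  set c₁ : ℝ := 2 ^ (n + s * p) / unitBallVol n with hc₁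
  set c₂ : ℝ := 2 ^ p * c₁ * (2 ^ m / unitBallVol n) ^ κ with hc₂
  have hc₂0 : 0 ≤ c₂ := by positivity
  refine ⟨ENNReal.ofReal c₂ ^ (m / p), by finiteness, fun u hu hus => ?_⟩
  have hNt : ∫⁻ x, ‖u x‖ₑ ^ m ≠ ∞ := by
    have h1 : MemLp u (ENNReal.ofReal m) volume := hu.memLp_of_hasCompactSupport hus
    have h2 := (eLpNorm_lt_top_iff_lintegral_rpow_enorm_lt_top (by simpa using hm0) (by simp)).1
      h1.eLpNorm_lt_top
    rw [ENNReal.toReal_ofReal hm0.le] at h2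
    exact h2.ne
  obtain ⟨N, hN0, hN⟩ : ∃ N : ℝ, 0 ≤ N ∧ ∫⁻ x, ‖u x‖ₑ ^ m = ENNReal.ofReal N :=
    ⟨_, ENNReal.toReal_nonneg, (ENNReal.ofReal_toReal hNt).symm⟩
  rcases hN0.eq_or_lt with rfl | hN0
  · rw [hN]; simp
  -- The radius `R` depends on `x` and is chosen so that `N / |B| = (b / 2) ^ m`. By Jensen the
  -- average over `B` is then at most `b / 2`, so `u x` differs from it by at least `b / 2`, and
  -- Poincaré applies. The surplus `b ^ (m - p)` cancels against `R ^ (s * p) = ρ ^ κ`, because `m -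
  -- p = m * κ`.
  have hpt : ∀ x, ‖u x‖ₑ ^ m ≤ ENNReal.ofReal (c₂ * N ^ κ) * innerGagliardo s p u x := by
    intro x
    rcases eq_or_ne (u x) 0 with h0 | h0
    · simp [h0, hm0]
    set b := ‖u x‖ with hb
    have hb0 : 0 < b := norm_pos_iff.2 h0
    have hbe : ‖u x‖ₑ = ENNReal.ofReal b := (ofReal_norm _).symm
    set ρ : ℝ := 2 ^ m * N / (unitBallVol n * b ^ m) with hρ
    have hρ0 : 0 < ρ := by positivity
    set R : ℝ := ρ ^ (1 / (n : ℝ)) with hR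
    have hR0 : 0 < R := by positivity
    have hRn : R ^ (n : ℝ) = ρ := by
      rw [hR, ← Real.rpow_mul hρ0.le, one_div_mul_cancel hn0.ne', Real.rpow_one]
    have hRsp : R ^ (s * p) = ρ ^ κ := by
      rw [hR, ← Real.rpow_mul hρ0.le, hκ]
      congr 1
      ring
    set B := Metric.ball x R
    have hB0 : volume B ≠ 0 := (Metric.measure_ball_pos _ _ hR0).ne'
    have : IsFiniteMeasure (volume.restrict B) := ⟨by simpa using measure_ball_lt_top⟩
    set A := ⨍ y in B, u y with hA
    have hA1 : ‖A‖ₑ ^ m ≤ ENNReal.ofReal ((b / 2) ^ m) := by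
      refine (enorm_average_rpow_le (by simpa [Measure.restrict_eq_zero] using hB0)
        hu.aemeasurable (by linarith)).trans ?_
      calc _ ≤ (volume B)⁻¹ * ENNReal.ofReal N := by
            rw [Measure.restrict_apply_univ, ← hN]
            gcongr
            exact Measure.restrict_le_self
        _ = ENNReal.ofReal ((b / 2) ^ m) := by
            rw [volume_ball_eq x hR0, hRn, ← ENNReal.ofReal_inv_of_pos (by positivity),
              ← ENNReal.ofReal_mul (by positivity)]
            congr 1
            rw [hρ, Real.div_rpow hb0.le (by norm_num)]
            field_simp
    have hA2 : ‖A‖ ≤ b / 2 := by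
      rw [← ofReal_norm, ENNReal.ofReal_rpow_of_nonneg (norm_nonneg _) hm0.le,
        ENNReal.ofReal_le_ofReal_iff (by positivity)] at hA1
      exact (Real.rpow_le_rpow_iff (norm_nonneg _) (by positivity) hm0).1 hA1
    have hA3 : b / 2 ≤ ‖u x - A‖ := by
      have := norm_sub_norm_le (u x) A
      linarith
    have hA4 : ENNReal.ofReal ((b / 2) ^ p) ≤
        ENNReal.ofReal (c₁ * R ^ (s * p)) * innerGagliardo s p u x := by
      refine le_trans ?_ (enorm_sub_average_rpow_le hs.le hp hu hR0 (Metric.mem_ball_self hR0))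
      rw [← ofReal_norm, ENNReal.ofReal_rpow_of_nonneg (norm_nonneg _) hp0.le]
      gcongr
    calc ‖u x‖ₑ ^ m = ENNReal.ofReal (2 ^ p * b ^ (m - p)) * ENNReal.ofReal ((b / 2) ^ p) := by
          rw [hbe, ENNReal.ofReal_rpow_of_nonneg hb0.le hm0.le,
            ← ENNReal.ofReal_mul (by positivity), Real.div_rpow hb0.le (by norm_num),
            Real.rpow_sub hb0]
          congr 1
          field_simp
      _ ≤ ENNReal.ofReal (2 ^ p * b ^ (m - p)) *
          (ENNReal.ofReal (c₁ * R ^ (s * p)) * innerGagliardo s p u x) := by gcongr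
      _ = _ := by
          rw [← mul_assoc, ← ENNReal.ofReal_mul (by positivity), hRsp]
          congr 2
          have h5 : ρ ^ κ = (2 ^ m / unitBallVol n) ^ κ * N ^ κ / b ^ (m - p) := by
            have : m - p = m * κ := by linarith
            rw [this, Real.rpow_mul hb0.le, ← Real.mul_rpow (by positivity) hN0.le,
              ← Real.div_rpow (by positivity) (by positivity), hρ]
            congr 1
            field_simp
          rw [h5, hc₂]
          field_simp
  -- `N` is finite, by compact support, and positive here, so `N ^ κ` can be divided out of the
  -- integrated bound. The remaining power `1 - κ` is `p / m`.
  have hmain : ENNReal.ofReal N ≤ ENNReal.ofReal (c₂ * N ^ κ) * gagliardo s p u ^ p := by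
    rw [← hN, ← lintegral_innerGagliardo hu hp0,
      ← lintegral_const_mul' _ _ ENNReal.ofReal_ne_top]
    exact lintegral_mono hpt
  have hmain2 : ENNReal.ofReal (N ^ (1 - κ)) ≤ ENNReal.ofReal c₂ * gagliardo s p u ^ p := by
    have h6 : ENNReal.ofReal (N ^ (1 - κ)) = ENNReal.ofReal ((N ^ κ)⁻¹) * ENNReal.ofReal N := by
      rw [← ENNReal.ofReal_mul (by positivity), Real.rpow_sub hN0, Real.rpow_one]
      congr 1
      field_simp
    rw [h6]
    refine (mul_le_mul_right hmain _).trans_eq ?_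
    rw [← mul_assoc, ← ENNReal.ofReal_mul (by positivity)]
    congr 2
    field_simp
  calc ∫⁻ x, ‖u x‖ₑ ^ m = ENNReal.ofReal (N ^ (1 - κ)) ^ (m / p) := by
        rw [hN, ENNReal.ofReal_rpow_of_nonneg (by positivity) (by positivity),
          ← Real.rpow_mul hN0.le]
        have : (1 - κ) * (m / p) = 1 := by
          rw [mul_div_assoc', mul_comm, hmκ, div_self hp0.ne']
        rw [this, Real.rpow_one]
    _ ≤ (ENNReal.ofReal c₂ * gagliardo s p u ^ p) ^ (m / p) := by gcongr
    _ = _ := by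
        rw [ENNReal.mul_rpow_of_nonneg _ _ (by positivity), ← ENNReal.rpow_mul,
          mul_div_cancel₀ _ hp0.ne']

/-! ### Weighted norms: estimates near infinity and on compact sets. -/

variable {q r : ℝ}

theorem weightNorm_rpow (hq : 0 < q) {w : Rn n → ℝ} (hw : AEMeasurable w volume)
    {u : Rn n → ℝ} (hu : Continuous u) :
    weightNorm q w u ^ q = ∫⁻ x, ENNReal.ofReal (w x) * ‖u x‖ₑ ^ q := by
  rw [weightNorm, eLpNorm_eq_lintegral_rpow_enorm_toReal (by simpa using hq) (by simp),
    ENNReal.toReal_ofReal hq.le, ← ENNReal.rpow_mul, one_div_mul_cancel hq.ne', ENNReal.rpow_one,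
    weightMeasure, lintegral_withDensity_eq_lintegral_mul₀ hw.ennreal_ofReal
      (hu.aemeasurable.enorm.pow_const q)]
  rfl

/-- Transfers almost-everywhere statements from the weighted spaces to Lebesgue measure, where
functions from different weighted spaces can be compared. -/
theorem volume_absolutelyContinuous_weightMeasure {w : Rn n → ℝ} (hw : AEMeasurable w volume)
    (hpos : ∀ x, 0 < w x) : volume ≪ weightMeasure w :=
  withDensity_absolutelyContinuous' hw.ennreal_ofReal
    (Eventually.of_forall fun x => (ENNReal.ofReal_pos.2 (hpos x)).ne')

theorem aemeasurable_of_memLp_restrict_compact {K : Rn n → ℝ} {t : ℝ≥0∞}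
    (hK : ∀ D : Set (Rn n), IsCompact D → MemLp K t (volume.restrict D)) :
    AEMeasurable K volume := by
  have h : AEMeasurable K (volume.restrict (⋃ k : ℕ, Metric.closedBall (0 : Rn n) k)) :=
    AEMeasurable.iUnion fun k =>
      (hK _ (isCompact_closedBall 0 (k : ℝ))).aestronglyMeasurable.aemeasurable
  rwa [Metric.iUnion_closedBall_nat, Measure.restrict_univ] at h

/-- Ensures that continuous functions of compact support belong to `L^r(K)`. -/
theorem isFiniteMeasureOnCompacts_weightMeasure {K : Rn n → ℝ} {t : ℝ≥0∞} (ht : 1 ≤ t)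
    (hK : ∀ D : Set (Rn n), IsCompact D → MemLp K t (volume.restrict D)) :
    IsFiniteMeasureOnCompacts (weightMeasure K) := by
  refine ⟨fun D hD => ?_⟩
  have : IsFiniteMeasure (volume.restrict D) := ⟨by simpa using hD.measure_lt_top⟩
  rw [weightMeasure, withDensity_apply _ hD.measurableSet]
  have h1 : Integrable K (volume.restrict D) := memLp_one_iff_integrable.1 ((hK D hD).mono_exponent ht)
  exact (lintegral_mono fun x => Real.ofReal_le_enorm (K x)).trans_lt h1.hasFiniteIntegral

theorem setLIntegral_rpow_le_of_weight_lower_bound (hq : 0 < q) {V : Rn n → ℝ}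
    (hV : AEMeasurable V volume) {u : Rn n → ℝ} (hu : Continuous u) {D : Set (Rn n)}
    (hD : MeasurableSet D) {c : ℝ} (hc : 0 < c) (hcV : ∀ x ∈ D, c ≤ V x) :
    ∫⁻ x in D, ‖u x‖ₑ ^ q ≤ ENNReal.ofReal c⁻¹ * weightNorm q V u ^ q := by
  rw [weightNorm_rpow hq hV hu, ← lintegral_const_mul' _ _ ENNReal.ofReal_ne_top]
  refine (setLIntegral_mono' hD fun x hx => ?_).trans (setLIntegral_le_lintegral D _)
  rw [← mul_assoc, ← ENNReal.ofReal_mul (by positivity)]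
  refine le_mul_of_one_le_left zero_le ?_
  rw [ENNReal.one_le_ofReal, inv_mul_eq_div, one_le_div hc]
  exact hcV x hx

/-- The part of the weighted `L^r` norm far from the origin is uniformly small. -/
theorem exists_tail_le (hn : 0 < n) (hs : 0 < s) (hp : 1 ≤ p) (hsp : s * p < n)
    (hr : critExp n s p ≤ r) (hrq : r < q) {K V : Rn n → ℝ}
    (hVpos : ∀ x, 0 < V x) (hV : AEMeasurable V volume)
    {τ : ℝ} (hτ : τ = (r - critExp n s p) / (q - critExp n s p))
    (hKV : Tendsto (fun x => K x * V x ^ (-τ)) (Bornology.cobounded (Rn n)) (𝓝 0))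
    {ε : ℝ} (hε : 0 < ε) :
    ∃ R : ℝ, ∀ u : Rn n → ℝ, Continuous u → HasCompactSupport u → weightNorm q V u ≤ 1 →
      gagliardo s p u ≤ 1 →
      ∫⁻ x in (Metric.closedBall 0 R)ᶜ, ENNReal.ofReal (K x) * ‖u x‖ₑ ^ r ≤ ENNReal.ofReal ε := by
  obtain ⟨C, hC, hSob⟩ := lintegral_critExp_rpow_le hn hs hp hsp
  have hm0 : 0 < critExp n s p := by
    rw [critExp]
    have : (0 : ℝ) < n := by exact_mod_cast hn
    exact div_pos (by positivity) (by linarith)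
  set m := critExp n s p
  have hmq : 0 < q - m := by linarith
  have hτ0 : 0 ≤ τ := by rw [hτ]; exact div_nonneg (by linarith) hmq.le
  have hτ1 : τ ≤ 1 := by rw [hτ, div_le_one hmq]; linarith
  have hrτ : m * (1 - τ) + q * τ = r := by
    have : τ * (q - m) = r - m := by rw [hτ, div_mul_cancel₀ _ hmq.ne']
    linarith
  have hCt : C ^ (1 - τ) ≠ ∞ := ENNReal.rpow_ne_top_of_nonneg (by linarith) hC
  -- Absorbs the Sobolev constant left by Hölder's inequality; the `+ 1` keeps the denominator
  -- positive.
  set η : ℝ := ε / ((C ^ (1 - τ)).toReal + 1) with hη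
  have hη0 : 0 < η := by positivity
  have hev := hKV.eventually (gt_mem_nhds hη0)
  obtain ⟨R, -, hR⟩ := (Metric.hasBasis_cobounded_compl_closedBall (0 : Rn n)).eventually_iff.1 hev
  refine ⟨R, fun u hu hus hu1 hu2 => ?_⟩
  have hpt : ∀ x ∈ (Metric.closedBall (0 : Rn n) R)ᶜ, ENNReal.ofReal (K x) * ‖u x‖ₑ ^ r ≤
      ENNReal.ofReal η *
        ((‖u x‖ₑ ^ m) ^ (1 - τ) * (ENNReal.ofReal (V x) * ‖u x‖ₑ ^ q) ^ τ) := by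
    intro x hx
    have h1 : K x ≤ η * V x ^ τ := by
      have := hR hx
      rw [Real.rpow_neg (hVpos x).le, ← div_eq_mul_inv,
        div_lt_iff₀ (Real.rpow_pos_of_pos (hVpos x) _)] at this
      exact this.le
    calc _ ≤ ENNReal.ofReal (η * V x ^ τ) * ‖u x‖ₑ ^ r := by gcongr
      _ = _ := by
        rw [ENNReal.mul_rpow_of_nonneg _ _ hτ0, ← ENNReal.rpow_mul, ← ENNReal.rpow_mul,
          mul_left_comm (‖u x‖ₑ ^ _), ← ENNReal.rpow_add_of_nonneg _ _
            (mul_nonneg hm0.le (by linarith)) (mul_nonneg (by linarith) hτ0), hrτ,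
          ENNReal.ofReal_mul hη0.le, ENNReal.ofReal_rpow_of_pos (hVpos x), mul_assoc]
  calc _ ≤ ∫⁻ x, ENNReal.ofReal η *
        ((‖u x‖ₑ ^ m) ^ (1 - τ) * (ENNReal.ofReal (V x) * ‖u x‖ₑ ^ q) ^ τ) :=
        (setLIntegral_mono' Metric.isClosed_closedBall.measurableSet.compl hpt).trans
          (setLIntegral_le_lintegral _ _)
    _ ≤ ENNReal.ofReal η * ((∫⁻ x, ‖u x‖ₑ ^ m) ^ (1 - τ) *
          (∫⁻ x, ENNReal.ofReal (V x) * ‖u x‖ₑ ^ q) ^ τ) := by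
        rw [lintegral_const_mul' _ _ ENNReal.ofReal_ne_top]
        gcongr
        exact ENNReal.lintegral_mul_norm_pow_le (hu.aemeasurable.enorm.pow_const _)
          (hV.ennreal_ofReal.mul (hu.aemeasurable.enorm.pow_const _)) (by linarith) hτ0 (by ring)
    _ ≤ ENNReal.ofReal η * (C ^ (1 - τ) * 1) := by
        have hτ' : 0 ≤ 1 - τ := by linarith
        gcongr
        · refine (hSob u hu hus).trans ?_
          exact mul_le_of_le_one_right' (ENNReal.rpow_le_one hu2 hm0.le)
        · rw [← weightNorm_rpow (by linarith) hV hu]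
          exact ENNReal.rpow_le_one (ENNReal.rpow_le_one hu1 (by linarith)) hτ0
    _ ≤ ENNReal.ofReal ε := by
        rw [mul_one, ← ENNReal.ofReal_toReal hCt, ← ENNReal.ofReal_mul hη0.le]
        apply ENNReal.ofReal_le_ofReal
        rw [hη, div_mul_eq_mul_div, div_le_iff₀ (by positivity)]
        nlinarith

/-- On a compact set the weighted `L^r` norm is controlled by the `L^p` norm, by interpolation. -/
theorem exists_local_le (hp : 1 ≤ p) (hpr : p ≤ r) (hrq : r < q) {K V : Rn n → ℝ}
    (hV : AEMeasurable V volume) {t : ℝ≥0∞}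
    (ht : ENNReal.ofReal (q / (q - r)) < t) {D : Set (Rn n)} (hD : IsCompact D)
    {c : ℝ} (hc : 0 < c) (hcV : ∀ x ∈ D, c ≤ V x)
    (hK : MemLp K t (volume.restrict D)) :
    ∃ C : ℝ≥0∞, C ≠ ∞ ∧ ∃ θ : ℝ, 0 < θ ∧ ∀ u : Rn n → ℝ, Continuous u → weightNorm q V u ≤ 1 →
      ∫⁻ x in D, ENNReal.ofReal (K x) * ‖u x‖ₑ ^ r ≤ C * (∫⁻ x in D, ‖u x‖ₑ ^ p) ^ θ := by
  have : IsFiniteMeasure (volume.restrict D) := ⟨by simpa using hD.measure_lt_top⟩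
  -- A finite exponent still above the threshold, since `t` may be `∞`.
  obtain ⟨t₀, -, ht₀, ht₀t⟩ := ENNReal.lt_iff_exists_real_btwn.1 ht
  have hqr : 0 < q - r := by linarith
  have hq0 : 0 < q := by linarith
  have ht₀' : q / (q - r) < t₀ := (ENNReal.ofReal_lt_ofReal_iff_of_nonneg (by positivity)).1 ht₀
  have ht0 : 0 < t₀ := lt_trans (by positivity) ht₀'
  have hKt : ∫⁻ x in D, ENNReal.ofReal (K x) ^ t₀ ≠ ∞ := by
    have h2 := (eLpNorm_lt_top_iff_lintegral_rpow_enorm_lt_top (by simpa using ht0) (by simp)).1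
      (hK.mono_exponent ht₀t.le).eLpNorm_lt_top
    rw [ENNReal.toReal_ofReal ht0.le] at h2
    refine ne_top_of_le_ne_top h2.ne (lintegral_mono fun x => ?_)
    gcongr
    exact Real.ofReal_le_enorm _
  set w₁ := 1 / t₀ with hw₁
  have hw₁0 : 0 < w₁ := by positivity
  have hw₁q : w₁ * q < q - r := by
    rw [hw₁, div_mul_eq_mul_div, one_mul, div_lt_iff₀ ht0]
    rwa [div_lt_iff₀ hqr, mul_comm] at ht₀'
  have hqp : 0 < q - p := by linarith
  -- The Hölder weights of `K ^ t₀`, `|u| ^ p` and `|u| ^ q` solve `w₁ + w₂ + w₃ = 1` and `p * w₂ +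
  -- q * w₃ = r`. Positivity of `w₂` is exactly `t₀ > q / (q - r)`.
  set w₂ := (q * (1 - w₁) - r) / (q - p) with hw₂
  set w₃ := (r - p * (1 - w₁)) / (q - p) with hw₃
  have hw₂0 : 0 < w₂ := div_pos (by linarith) hqp
  have hw₃0 : 0 ≤ w₃ := div_nonneg (by nlinarith) hqp.le
  have hsum : w₁ + (w₂ + w₃) = 1 := by
    rw [hw₂, hw₃]
    field_simp
    ring
  have hexp : p * w₂ + q * w₃ = r := by
    rw [hw₂, hw₃]
    field_simp
    ring
  refine ⟨(∫⁻ x in D, ENNReal.ofReal (K x) ^ t₀) ^ w₁ * ENNReal.ofReal c⁻¹ ^ w₃, ?_, w₂, hw₂0,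
    fun u hu hu1 => ?_⟩
  · exact ENNReal.mul_ne_top (ENNReal.rpow_ne_top_of_nonneg hw₁0.le hKt)
      (ENNReal.rpow_ne_top_of_nonneg hw₃0 ENNReal.ofReal_ne_top)
  have hH := ENNReal.lintegral_mul_prod_norm_pow_le (μ := volume.restrict D) Finset.univ
    (g := fun x => ENNReal.ofReal (K x) ^ t₀)
    (f := ![fun x => ‖u x‖ₑ ^ p, fun x => ‖u x‖ₑ ^ q])
    (hK.aestronglyMeasurable.aemeasurable.ennreal_ofReal.pow_const _)
    (by
      intro i _
      fin_cases i
      · exact hu.aemeasurable.enorm.pow_const _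
      · exact hu.aemeasurable.enorm.pow_const _) w₁ (p := ![w₂, w₃])
    (by simpa [Fin.sum_univ_two] using hsum) hw₁0.le
    (by
      intro i _
      fin_cases i
      · exact hw₂0.le
      · exact hw₃0)
  simp only [Fin.prod_univ_two, Matrix.cons_val_zero, Matrix.cons_val_one] at hH
  have hint : ∀ x, ENNReal.ofReal (K x) * ‖u x‖ₑ ^ r =
      (ENNReal.ofReal (K x) ^ t₀) ^ w₁ * ((‖u x‖ₑ ^ p) ^ w₂ * (‖u x‖ₑ ^ q) ^ w₃) := fun x => by
    rw [← ENNReal.rpow_mul, ← ENNReal.rpow_mul, ← ENNReal.rpow_mul,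
      ← ENNReal.rpow_add_of_nonneg _ _ (by positivity) (by positivity), hexp, hw₁,
      mul_one_div_cancel ht0.ne', ENNReal.rpow_one]
  simp only [hint]
  refine hH.trans ?_
  rw [mul_right_comm, mul_assoc]
  gcongr
  refine (setLIntegral_rpow_le_of_weight_lower_bound hq0 hV hu hD.measurableSet hc hcV).trans ?_
  exact mul_le_of_le_one_right' (ENNReal.rpow_le_one hu1 hq0.le)

/-- A function of Gagliardo seminorm at most `1` with small averages over finitely many suitable
balls is small in `L^p` of a compact set. -/
theorem exists_finite_averages_control (hs : 0 < s) (hp : 1 ≤ p) {D : Set (Rn n)}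
    (hD : IsCompact D) {ε : ℝ} (hε : 0 < ε) :
    ∃ (F : Finset (Rn n)) (δ : ℝ) (η : ℝ), 0 < δ ∧ 0 < η ∧ ∀ u : Rn n → ℝ, Continuous u →
      gagliardo s p u ≤ 1 → (∀ a ∈ F, |⨍ y in Metric.ball a δ, u y| ≤ η) →
      ∫⁻ x in D, ‖u x‖ₑ ^ p ≤ ENNReal.ofReal ε := by
  have hp0 : 0 < p := by linarith
  have hω := unitBallVol_pos (n := n)
  set c₀ : ℝ := 2 ^ (p - 1) with hc₀
  set c₁ : ℝ := 2 ^ (n + s * p) / unitBallVol n with hc₁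
  have hc₀0 : 0 < c₀ := by positivity
  have hc₁0 : 0 < c₁ := by positivity
  set M : ℝ := (volume D).toReal with hM
  have hM0 : 0 ≤ M := ENNReal.toReal_nonneg
  -- `δ` makes the Poincaré error `ε / 2`, and `η` below bounds the contribution of the averages by
  -- `ε / 2`; `c₀` comes from convexity of the `p`-th power.
  set δ : ℝ := (ε / (2 * c₀ * c₁)) ^ (1 / (s * p)) with hδ
  have hδ0 : 0 < δ := by positivity
  have hδ1 : δ ^ (s * p) = ε / (2 * c₀ * c₁) := by
    rw [hδ, ← Real.rpow_mul (by positivity), one_div_mul_cancel (by positivity), Real.rpow_one]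
  set η : ℝ := (ε / (2 * c₀ * (M + 1))) ^ (1 / p) with hη
  have hη0 : 0 < η := by positivity
  have hη1 : η ^ p = ε / (2 * c₀ * (M + 1)) := by
    rw [hη, ← Real.rpow_mul (by positivity), one_div_mul_cancel (by positivity), Real.rpow_one]
  obtain ⟨F, -, hFf, hF⟩ := hD.finite_cover_balls hδ0
  refine ⟨hFf.toFinset, δ, η, hδ0, hη0, fun u hu hu1 hA => ?_⟩
  have hpt : ∀ x ∈ D, ‖u x‖ₑ ^ p ≤ ENNReal.ofReal (c₀ * c₁ * δ ^ (s * p)) *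
      innerGagliardo s p u x + ENNReal.ofReal (c₀ * η ^ p) := by
    intro x hx
    obtain ⟨a, ha, hxa⟩ : ∃ a ∈ F, x ∈ Metric.ball a δ := by simpa using hF hx
    set A := ⨍ y in Metric.ball a δ, u y with hAdef
    have h1 : ‖A‖ₑ ^ p ≤ ENNReal.ofReal (η ^ p) := by
      rw [← ofReal_norm, ENNReal.ofReal_rpow_of_nonneg (norm_nonneg _) hp0.le]
      have := hA a (by simpa using ha)
      rw [Real.norm_eq_abs]
      gcongr
    have h2 := enorm_sub_average_rpow_le hs.le hp hu hδ0 hxa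
    calc ‖u x‖ₑ ^ p = ‖(u x - A) + A‖ₑ ^ p := by rw [sub_add_cancel]
      _ ≤ (‖u x - A‖ₑ + ‖A‖ₑ) ^ p := by gcongr; exact enorm_add_le _ _
      _ ≤ 2 ^ (p - 1) * (‖u x - A‖ₑ ^ p + ‖A‖ₑ ^ p) :=
          ENNReal.rpow_add_le_mul_rpow_add_rpow _ _ hp
      _ ≤ ENNReal.ofReal c₀ * (ENNReal.ofReal (c₁ * δ ^ (s * p)) * innerGagliardo s p u x +
            ENNReal.ofReal (η ^ p)) := by
          gcongr
          rw [hc₀, ← ENNReal.ofReal_rpow_of_pos (by norm_num), ENNReal.ofReal_ofNat]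
      _ = _ := by
          rw [mul_add, ← mul_assoc, ← ENNReal.ofReal_mul hc₀0.le, ← ENNReal.ofReal_mul hc₀0.le,
            mul_assoc c₀]
  calc ∫⁻ x in D, ‖u x‖ₑ ^ p
      ≤ ∫⁻ x in D, (ENNReal.ofReal (c₀ * c₁ * δ ^ (s * p)) * innerGagliardo s p u x +
          ENNReal.ofReal (c₀ * η ^ p)) := setLIntegral_mono' hD.measurableSet hpt
    _ = ENNReal.ofReal (c₀ * c₁ * δ ^ (s * p)) * (∫⁻ x in D, innerGagliardo s p u x) +
          ENNReal.ofReal (c₀ * η ^ p) * volume D := by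
        rw [lintegral_add_right _ measurable_const, lintegral_const_mul' _ _ ENNReal.ofReal_ne_top,
          setLIntegral_const]
    _ ≤ ENNReal.ofReal (c₀ * c₁ * δ ^ (s * p)) * 1 +
          ENNReal.ofReal (c₀ * η ^ p) * ENNReal.ofReal M := by
        gcongr
        · refine (setLIntegral_le_lintegral _ _).trans ?_
          rw [lintegral_innerGagliardo hu hp0]
          exact ENNReal.rpow_le_one hu1 hp0.le
        · rw [hM, ENNReal.ofReal_toReal hD.measure_lt_top.ne]
    _ ≤ ENNReal.ofReal ε := by
        rw [mul_one, ← ENNReal.ofReal_mul (by positivity),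
          ← ENNReal.ofReal_add (by positivity) (by positivity)]
        apply ENNReal.ofReal_le_ofReal
        rw [hδ1, hη1]
        have e1 : c₀ * c₁ * (ε / (2 * c₀ * c₁)) = ε / 2 := by field_simp
        have e2 : c₀ * (ε / (2 * c₀ * (M + 1))) * M = ε / 2 * (M / (M + 1)) := by field_simp
        have e3 : M / (M + 1) ≤ 1 := by rw [div_le_one (by positivity)]; linarith
        rw [e1, e2]
        nlinarith

/-! ### The completion as a space of functions. -/

/-- The underlying spaces may differ, as they do when functions on `ℝⁿ` are paired with difference
quotients on `ℝⁿ × ℝⁿ`. The second subsequence is extracted from the first. -/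
theorem exists_subseq_tendsto_ae_of_tendsto_Lp {α β : Type*} [MeasurableSpace α]
    [MeasurableSpace β] {μ : Measure α} {ν : Measure β} {a b : ℝ≥0∞} [Fact (1 ≤ a)] [Fact (1 ≤ b)]
    {f : ℕ → Lp ℝ a μ} {f₀ : Lp ℝ a μ} {g : ℕ → Lp ℝ b ν} {g₀ : Lp ℝ b ν}
    (hf : Tendsto f atTop (𝓝 f₀)) (hg : Tendsto g atTop (𝓝 g₀)) :
    ∃ φ : ℕ → ℕ, (∀ᵐ x ∂μ, Tendsto (fun k => f (φ k) x) atTop (𝓝 (f₀ x))) ∧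
      ∀ᵐ x ∂ν, Tendsto (fun k => g (φ k) x) atTop (𝓝 (g₀ x)) := by
  obtain ⟨φ, hφ, h1⟩ := (tendstoInMeasure_of_tendsto_Lp hf).exists_seq_tendsto_ae
  obtain ⟨ψ, hψ, h2⟩ :=
    (tendstoInMeasure_of_tendsto_Lp (hg.comp hφ.tendsto_atTop)).exists_seq_tendsto_ae
  refine ⟨φ ∘ ψ, ?_, h2⟩
  filter_upwards [h1] with x hx
  exact hx.comp hψ.tendsto_atTop

variable {V : Rn n → ℝ} [Fact (1 ≤ p)] [Fact (1 ≤ q)]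

theorem MSpace.exists_seq_tendsto (u : MSpace s p q V) :
    ∃ v : ℕ → TestFun s p q V, Tendsto (fun k => (v k : MSpace s p q V)) atTop (𝓝 u) := by
  obtain ⟨x, hx, hxu⟩ := mem_closure_iff_seq_limit.1
    (UniformSpace.Completion.denseRange_coe (α := TestFun s p q V) u)
  choose v hv using hx
  exact ⟨v, by simpa [hv] using hxu⟩

/-- A continuous linear map from `M_V^{s;q,p}` to a weighted Lebesgue space that is the identity on
test functions is the identity as a map of functions. -/
theorem MSpace.ae_eq_toFun [Fact (1 ≤ r)] {K : Rn n → ℝ} (hK : volume ≪ weightMeasure K)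
    (hV : volume ≪ weightMeasure V) (T : MSpace s p q V →L[ℝ] WeightedLp r K)
    (hT : ∀ u : TestFun s p q V, (T u : Rn n → ℝ) =ᵐ[volume] u.toFun) (u : MSpace s p q V) :
    (T u : Rn n → ℝ) =ᵐ[volume] MSpace.toFun u := by
  obtain ⟨v, hv⟩ := MSpace.exists_seq_tendsto u
  obtain ⟨φ, h1, h2⟩ := exists_subseq_tendsto_ae_of_tendsto_Lp ((T.continuous.tendsto u).comp hv)
    (((MSpace.toWeightedLp s p q V).continuous.tendsto u).comp hv)
  have h3 : ∀ᵐ x, ∀ k, (T (v k) : Rn n → ℝ) x = (v k).toFun x := ae_all_iff.2 fun k => hT (v k)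
  have h4 : ∀ᵐ x, ∀ k, (MSpace.toWeightedLp s p q V (v k) : Rn n → ℝ) x = (v k).toFun x :=
    ae_all_iff.2 fun k => hV.ae_le (MSpace.toFun_coe (v k))
  filter_upwards [hK.ae_le h1, hV.ae_le h2, h3, h4] with x a1 a2 a3 a4
  simp only [Function.comp_apply, a3, a4] at a1 a2
  exact tendsto_nhds_unique a1 a2

theorem TestFun.memLp_diffQuot (u : TestFun s p q V) :
    MemLp (diffQuot s p u.toFun) (ENNReal.ofReal p) (volume : Measure (Rn n × Rn n)) :=
  ⟨aestronglyMeasurable_diffQuot s p u.contDiff.continuous, u.gagliardo_ne_top.lt_top⟩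

variable (s p q V) in
/-- The difference quotient as a map from test functions to `L^p(ℝⁿ × ℝⁿ)`. -/
def TestFun.toDiffQuot :
    TestFun s p q V →L[ℝ] Lp ℝ (ENNReal.ofReal p) (volume : Measure (Rn n × Rn n)) :=
  LinearMap.mkContinuous
    { toFun := fun u => u.memLp_diffQuot.toLp (diffQuot s p u.toFun)
      map_add' := fun u v => by
        rw [← MemLp.toLp_add]
        exact MemLp.toLp_congr _ _ (by rw [TestFun.toFun_add, diffQuot_add])
      map_smul' := fun c u => by
        rw [RingHom.id_apply, ← MemLp.toLp_const_smul]
        exact MemLp.toLp_congr _ _ (by rw [TestFun.toFun_smul, diffQuot_smul]) } 1 (by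
    intro u
    rw [one_mul, TestFun.norm_def]
    change ‖u.memLp_diffQuot.toLp (diffQuot s p u.toFun)‖ ≤ _
    rw [Lp.norm_toLp]
    exact le_add_of_nonneg_left ENNReal.toReal_nonneg)

variable (s p q V) in
/-- The difference quotient as a map from `M_V^{s;q,p}(ℝⁿ)` to `L^p(ℝⁿ × ℝⁿ)`. -/
def MSpace.toDiffQuot :
    MSpace s p q V →L[ℝ] Lp ℝ (ENNReal.ofReal p) (volume : Measure (Rn n × Rn n)) :=
  (TestFun.toDiffQuot s p q V).extend
    (UniformSpace.Completion.toComplL : TestFun s p q V →L[ℝ] MSpace s p q V)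

theorem MSpace.toDiffQuot_coe (u : TestFun s p q V) :
    MSpace.toDiffQuot s p q V (u : MSpace s p q V) = TestFun.toDiffQuot s p q V u := by
  have h := ContinuousLinearMap.extend_eq (TestFun.toDiffQuot s p q V)
    (e := (UniformSpace.Completion.toComplL : TestFun s p q V →L[ℝ] MSpace s p q V))
    (by simpa using UniformSpace.Completion.denseRange_coe)
    (by simpa using UniformSpace.Completion.isUniformInducing_coe (TestFun s p q V)) u
  exact h

/-- By density from test functions. Thus an element vanishes as soon as both of its components do,
which reduces closability to the difference quotient. -/
theorem MSpace.norm_eq (u : MSpace s p q V) :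
    ‖u‖ = ‖MSpace.toWeightedLp s p q V u‖ + ‖MSpace.toDiffQuot s p q V u‖ := by
  induction u using UniformSpace.Completion.induction_on with
  | hp => exact isClosed_eq (by fun_prop) (by fun_prop)
  | ih u =>
    rw [UniformSpace.Completion.norm_coe, MSpace.toWeightedLp_coe, MSpace.toDiffQuot_coe,
      TestFun.norm_def]
    change _ = ‖u.memLp.toLp u.toFun‖ + ‖u.memLp_diffQuot.toLp (diffQuot s p u.toFun)‖
    rw [Lp.norm_toLp, Lp.norm_toLp]
    rfl

/-- The norm of `M_V^{s;q,p}` is closable: the function represented by an element determines it. -/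
theorem MSpace.eq_zero_of_toWeightedLp_eq_zero (hV : volume ≪ weightMeasure V)
    {u : MSpace s p q V} (hu : MSpace.toWeightedLp s p q V u = 0) : u = 0 := by
  obtain ⟨v, hv⟩ := MSpace.exists_seq_tendsto u
  have t1 := ((MSpace.toWeightedLp s p q V).continuous.tendsto u).comp hv
  rw [hu] at t1
  obtain ⟨φ, h1, h2⟩ := exists_subseq_tendsto_ae_of_tendsto_Lp t1
    (((MSpace.toDiffQuot s p q V).continuous.tendsto u).comp hv)
  have h3 : ∀ᵐ x, ∀ k, (MSpace.toWeightedLp s p q V (v k) : Rn n → ℝ) x = (v k).toFun x :=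
    ae_all_iff.2 fun k => hV.ae_le (MSpace.toFun_coe (v k))
  have h4 : ∀ᵐ z : Rn n × Rn n, ∀ k, (MSpace.toDiffQuot s p q V (v k) : Rn n × Rn n → ℝ) z =
      diffQuot s p (v k).toFun z := ae_all_iff.2 fun k => by
    rw [MSpace.toDiffQuot_coe]
    exact (v k).memLp_diffQuot.coeFn_toLp
  have h5 : ∀ᵐ x : Rn n, Tendsto (fun k => (v (φ k)).toFun x) atTop (𝓝 0) := by
    filter_upwards [hV.ae_le h1, h3, hV.ae_le (Lp.coeFn_zero ℝ (ENNReal.ofReal q) (weightMeasure V))]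
      with x a1 a3 a0
    rw [a0] at a1
    simpa only [Function.comp_apply, a3, Pi.zero_apply] using a1
  have h6 : MSpace.toDiffQuot s p q V u = 0 := by
    rw [Lp.eq_zero_iff_ae_eq_zero]
    have e1 : ∀ᵐ z : Rn n × Rn n, Tendsto (fun k => (v (φ k)).toFun z.1) atTop (𝓝 0) :=
      Measure.quasiMeasurePreserving_fst.ae h5
    have e2 : ∀ᵐ z : Rn n × Rn n, Tendsto (fun k => (v (φ k)).toFun z.2) atTop (𝓝 0) :=
      Measure.quasiMeasurePreserving_snd.ae h5
    filter_upwards [h2, h4, e1, e2] with z a2 a4 b1 b2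
    simp only [Function.comp_apply, a4] at a2
    -- For fixed `z` the denominator is a constant, so the diagonal needs no special care.
    have := (b1.sub b2).div_const (‖z.1 - z.2‖ ^ (n / p + s))
    simp only [sub_zero, zero_div] at this
    exact tendsto_nhds_unique a2 this
  rw [← norm_eq_zero, MSpace.norm_eq, hu, h6, norm_zero, norm_zero, add_zero]

/-! ### Finitely many constraints on the unit ball of test functions. -/

theorem TestFun.weightNorm_le_one {u : TestFun s p q V} (hu : ‖u‖ ≤ 1) :
    weightNorm q V u.toFun ≤ 1 := by
  rw [TestFun.norm_def] at hu
  rw [← ENNReal.ofReal_toReal u.weightNorm_ne_top, ENNReal.ofReal_le_one]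
  have := ENNReal.toReal_nonneg (a := gagliardo s p u.toFun)
  linarith

theorem TestFun.gagliardo_le_one {u : TestFun s p q V} (hu : ‖u‖ ≤ 1) :
    gagliardo s p u.toFun ≤ 1 := by
  rw [TestFun.norm_def] at hu
  rw [← ENNReal.ofReal_toReal u.gagliardo_ne_top, ENNReal.ofReal_le_one]
  have := ENNReal.toReal_nonneg (a := weightNorm q V u.toFun)
  linarith

/-- Averages over balls are bounded linear functionals on test functions. -/
theorem TestFun.exists_averageCLM (hV : AEMeasurable V volume)
    (hVlow : ∀ D : Set (Rn n), IsCompact D → ∃ c : ℝ, 0 < c ∧ ∀ x ∈ D, c ≤ V x)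
    (a : Rn n) {δ : ℝ} (hδ : 0 < δ) :
    ∃ A : TestFun s p q V →L[ℝ] ℝ, ∀ u, A u = ⨍ y in Metric.ball a δ, u.toFun y := by
  have hq1 : 1 ≤ q := Fact.out
  have hq0 : 0 < q := by linarith
  obtain ⟨c, hc, hcV⟩ := hVlow _ (isCompact_closedBall a δ)
  set B := Metric.ball a δ
  have hB0 : volume B ≠ 0 := (Metric.measure_ball_pos _ _ hδ).ne'
  have hBt : volume B ≠ ∞ := measure_ball_lt_top.ne
  have : IsFiniteMeasure (volume.restrict B) := ⟨by simpa using hBt.lt_top⟩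
  have hint : ∀ u : TestFun s p q V, IntegrableOn u.toFun B := fun u =>
    (u.contDiff.continuous.continuousOn.integrableOn_compact (isCompact_closedBall a δ)).mono_set
      Metric.ball_subset_closedBall
  set C : ℝ≥0∞ := ((volume B)⁻¹ * ENNReal.ofReal c⁻¹) ^ (1 / q) with hC
  have hCt : C ≠ ∞ := ENNReal.rpow_ne_top_of_nonneg (by positivity)
    (ENNReal.mul_ne_top (ENNReal.inv_ne_top.2 hB0) ENNReal.ofReal_ne_top)
  -- Jensen with exponent `q`, followed by the lower bound `c ≤ V` on the closed ball.
  have hbound : ∀ u : TestFun s p q V,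
      ‖⨍ y in B, u.toFun y‖ₑ ≤ C * weightNorm q V u.toFun := by
    intro u
    have hu := u.contDiff.continuous
    rw [← ENNReal.rpow_le_rpow_iff hq0]
    refine (enorm_average_rpow_le (by simpa [Measure.restrict_eq_zero] using hB0)
      hu.aemeasurable hq1).trans ?_
    rw [ENNReal.mul_rpow_of_nonneg _ _ hq0.le, hC, ← ENNReal.rpow_mul,
      one_div_mul_cancel hq0.ne', ENNReal.rpow_one, mul_assoc, Measure.restrict_apply_univ]
    gcongr
    exact setLIntegral_rpow_le_of_weight_lower_bound hq0 hV hu measurableSet_ball hc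
      fun x hx => hcV x (Metric.ball_subset_closedBall hx)
  refine ⟨LinearMap.mkContinuous
    { toFun := fun u => ⨍ y in B, u.toFun y
      map_add' := fun u v => by
        simp only [setAverage_eq, TestFun.toFun_add, Pi.add_apply]
        rw [integral_add (hint u) (hint v), smul_add]
      map_smul' := fun k u => by
        simp only [setAverage_eq, TestFun.toFun_smul, Pi.smul_apply, RingHom.id_apply]
        rw [integral_smul, smul_comm] } C.toReal ?_, fun u => rfl⟩
  intro u
  have h1 := ENNReal.toReal_mono (ENNReal.mul_ne_top hCt u.weightNorm_ne_top) (hbound u)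
  rw [toReal_enorm, ENNReal.toReal_mul] at h1
  refine h1.trans ?_
  gcongr
  exact le_add_of_nonneg_right ENNReal.toReal_nonneg

/-- On the unit ball of the test functions, the `L^r(K)` norm is small up to finitely many bounded
linear constraints. -/
theorem TestFun.exists_constraints (hn : 0 < n) (hs : 0 < s) (hsp : s * p < n)
    (hr : critExp n s p ≤ r) (hrq : r < q) {K : Rn n → ℝ}
    (hVpos : ∀ x, 0 < V x) (hV : AEMeasurable V volume)
    (hVlow : ∀ D : Set (Rn n), IsCompact D → ∃ c : ℝ, 0 < c ∧ ∀ x ∈ D, c ≤ V x)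
    {t : ℝ≥0∞} (ht : ENNReal.ofReal (q / (q - r)) < t)
    (hK : ∀ D : Set (Rn n), IsCompact D → MemLp K t (volume.restrict D)) {τ : ℝ}
    (hτ : τ = (r - critExp n s p) / (q - critExp n s p))
    (hKV : Tendsto (fun x => K x * V x ^ (-τ)) (Bornology.cobounded (Rn n)) (𝓝 0))
    {ε : ℝ} (hε : 0 < ε) :
    ∃ (ι : Type) (_ : Fintype ι) (A : TestFun s p q V →L[ℝ] (ι → ℝ)),
      ∀ u : TestFun s p q V, ‖u‖ ≤ 1 → ‖A u‖ ≤ 1 →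
        weightNorm r K u.toFun ≤ ENNReal.ofReal ε := by
  have hp1 : 1 ≤ p := Fact.out
  have hpm : p ≤ critExp n s p := by
    rw [critExp, le_div_iff₀ (by linarith)]
    nlinarith [mul_pos hs (by linarith : 0 < p)]
  have hr0 : 0 < r := by linarith
  have hKm := aemeasurable_of_memLp_restrict_compact hK
  set E : ℝ := ε ^ r / 2 with hE
  have hE0 : 0 < E := by positivity
  obtain ⟨R, hR⟩ := exists_tail_le hn hs hp1 hsp hr hrq hVpos hV hτ hKV hE0
  have hD := isCompact_closedBall (0 : Rn n) R
  obtain ⟨c, hc, hcV⟩ := hVlow _ hD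
  obtain ⟨C, hC, θ, hθ, hloc⟩ :=
    exists_local_le hp1 (hpm.trans hr) hrq hV ht hD hc hcV (hK _ hD)
  -- The tolerance undoes the power `θ` and the constant `C` of the local estimate, leaving at most
  -- `E`, half of `ε ^ r`.
  obtain ⟨F, δ, η, hδ, hη, hF⟩ := exists_finite_averages_control hs hp1 hD
    (ε := (E / (C.toReal + 1)) ^ (1 / θ)) (by positivity)
  choose A hA using fun a => TestFun.exists_averageCLM (s := s) (p := p) (q := q) hV hVlow a hδ
  -- After scaling by `η⁻¹`, sup norm at most `1` says that every average is at most `η` in absolute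
  -- value.
  refine ⟨Fin F.card, inferInstance,
    ContinuousLinearMap.pi fun i => η⁻¹ • A (F.equivFin.symm i), fun u hu hAu => ?_⟩
  have huc := u.contDiff.continuous
  have hu1 := TestFun.weightNorm_le_one hu
  have hu2 := TestFun.gagliardo_le_one hu
  have hav : ∀ a ∈ F, |⨍ y in Metric.ball a δ, u.toFun y| ≤ η := by
    intro a ha
    have := (norm_le_pi_norm _ (F.equivFin ⟨a, ha⟩)).trans hAu
    simp only [ContinuousLinearMap.coe_pi', smul_apply,
      Equiv.symm_apply_apply, hA, smul_eq_mul, norm_mul, norm_inv, Real.norm_eq_abs,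
      abs_of_pos hη] at this
    rwa [inv_mul_le_iff₀ hη, mul_one] at this
  rw [← ENNReal.rpow_le_rpow_iff hr0, weightNorm_rpow hr0 hKm huc,
    ← lintegral_add_compl _ hD.measurableSet, ENNReal.ofReal_rpow_of_pos hε]
  have h1 : ∫⁻ x in Metric.closedBall 0 R, ENNReal.ofReal (K x) * ‖u.toFun x‖ₑ ^ r ≤
      ENNReal.ofReal E := by
    refine (hloc _ huc hu1).trans ?_
    calc _ ≤ C * ENNReal.ofReal ((E / (C.toReal + 1)) ^ (1 / θ)) ^ θ := by
          gcongr
          exact hF _ huc hu2 hav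
      _ = ENNReal.ofReal (C.toReal * (E / (C.toReal + 1))) := by
          rw [ENNReal.ofReal_rpow_of_nonneg (by positivity) hθ.le, ← Real.rpow_mul (by positivity),
            one_div_mul_cancel hθ.ne', Real.rpow_one, ENNReal.ofReal_mul ENNReal.toReal_nonneg,
            ENNReal.ofReal_toReal hC]
      _ ≤ _ := by
          apply ENNReal.ofReal_le_ofReal
          rw [mul_div_assoc', div_le_iff₀ (by positivity)]
          nlinarith
  calc _ ≤ ENNReal.ofReal E + ENNReal.ofReal E :=
        add_le_add h1 (hR _ huc u.hasCompactSupport hu1 hu2)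
    _ = _ := by
        rw [← ENNReal.ofReal_add hE0.le hE0.le, hE, add_halves]

end WeightedFracSobolev

end

/-! ### The compact embedding. -/

open WeightedFracSobolev

theorem theorem6 (n : ℕ) (hn : 2 ≤ n) (s p q r : ℝ)
    [Fact (1 ≤ p)] [Fact (1 ≤ q)] [Fact (1 ≤ r)]
    (hs0 : 0 < s) (hs1 : s < 1) (hsp : s * p < n)
    (hr : WeightedFracSobolev.critExp n s p ≤ r) (hrq : r < q)
    (K V : EuclideanSpace ℝ (Fin n) → ℝ)
    (hKpos : ∀ x, 0 < K x) (hVpos : ∀ x, 0 < V x)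
    (hVmeas : AEMeasurable V volume)
    (hVlow : ∀ D : Set (EuclideanSpace ℝ (Fin n)), IsCompact D → ∃ c : ℝ, 0 < c ∧ ∀ x ∈ D, c ≤ V x)
    (t : ℝ≥0∞) (ht : ENNReal.ofReal (q / (q - r)) < t)
    (hK : ∀ D : Set (EuclideanSpace ℝ (Fin n)), IsCompact D → MemLp K t (volume.restrict D))
    (τ : ℝ)
    (hτ : τ = (r - WeightedFracSobolev.critExp n s p) / (q - WeightedFracSobolev.critExp n s p))
    (hKV : Tendsto (fun x => K x * V x ^ (-τ))
      (Bornology.cobounded (EuclideanSpace ℝ (Fin n))) (𝓝 0)) :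
    ∃ T : WeightedFracSobolev.MSpace s p q V →L[ℝ] WeightedFracSobolev.WeightedLp r K,
      (∀ u : WeightedFracSobolev.MSpace s p q V,
        (T u : EuclideanSpace ℝ (Fin n) → ℝ) =ᵐ[volume] WeightedFracSobolev.MSpace.toFun u) ∧
      Function.Injective T ∧ IsCompactOperator T := by
  have hr1 : 1 ≤ r := Fact.out
  have ht1 : 1 ≤ t := by
    refine le_trans ?_ ht.le
    rw [ENNReal.one_le_ofReal, one_le_div (by linarith)]
    linarith
  have hKac := volume_absolutelyContinuous_weightMeasure
    (aemeasurable_of_memLp_restrict_compact hK) hKpos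
  have hVac := volume_absolutelyContinuous_weightMeasure hVmeas hVpos
  have := isFiniteMeasureOnCompacts_weightMeasure ht1 hK
  have hmem : ∀ u : TestFun s p q V, MemLp u.toFun (ENNReal.ofReal r) (weightMeasure K) :=
    fun u => u.contDiff.continuous.memLp_of_hasCompactSupport u.hasCompactSupport
  let T₀ : TestFun s p q V →ₗ[ℝ] WeightedLp r K :=
    { toFun := fun u => (hmem u).toLp u.toFun
      map_add' := fun u v => MemLp.toLp_add (hmem u) (hmem v)
      map_smul' := fun c u => MemLp.toLp_const_smul c (hmem u) }
  obtain ⟨T, hT, hTc⟩ := T₀.exists_compact_extension fun ε hε => by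
    obtain ⟨ι, hι, A, hA⟩ := TestFun.exists_constraints (s := s) (p := p) (by omega) hs0 hsp hr hrq
      hVpos hVmeas hVlow ht hK hτ hKV hε
    refine ⟨ι, hι, A, fun u hu hAu => ?_⟩
    change ‖(hmem u).toLp u.toFun‖ ≤ ε
    rw [Lp.norm_toLp]
    exact ENNReal.toReal_le_of_le_ofReal hε.le (hA u hu hAu)
  have hTu : ∀ u : MSpace s p q V, (T u : Rn n → ℝ) =ᵐ[volume] MSpace.toFun u :=
    MSpace.ae_eq_toFun hKac hVac T fun u => by
      rw [hT]
      exact hKac.ae_le (hmem u).coeFn_toLp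
  refine ⟨T, hTu, ?_, hTc⟩
  rw [injective_iff_map_eq_zero]
  intro u hu
  -- `T u = 0` only says that the represented function vanishes almost everywhere; closability turns
  -- this into `u = 0`.
  refine MSpace.eq_zero_of_toWeightedLp_eq_zero hVac ?_
  rw [Lp.eq_zero_iff_ae_eq_zero]
  refine (withDensity_absolutelyContinuous _ _).ae_le ?_
  have h1 := hTu u
  rw [hu] at h1
  exact h1.symm.trans (hKac.ae_le (Lp.coeFn_zero ℝ (ENNReal.ofReal r) (weightMeasure K)))
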